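/- Let $G=(V,E)$ be a finite undirected graph, $R\subseteq V$ a set of terminals with $|R|\ge 2$ and $r\in R$ a root. Let $D=(V,A)$ be the directed graph that has the two arcs $(i,j)$ and $(j,i)$ for every edge $\{i,j\}\in E$, and write $\delta^+(i)$ and $\delta^-(i)$ for the sets of arcs of $D$ leaving and entering $i$. Let $K$ be a set of commodities, one for each terminal other than $r$; $t_k\in R\setminus\{r\}$ denotes the terminal of $k\in K$, so that $k\mapsto t_k$ is a bijection from $K$ to $R\setminus\{r\}$. Let $l$ be a laminar family on $K$, that is, a set $S(l)$ of nonempty subsets of $K$ which contains $K$ and all singletons $\{k\}$, and in which any two members are disjoint or one contains the other. For $s\in S(l)$ with $|s|\ge 2$, the children of $s$ are the maximal members of $S(l)$ properly contained in $s$; they form a partition $P_l(s)$ of $s$. Let $P(l)=\{P_l(s): s\in S(l),\ |s|\ge 2\}$. Consider the following linear equations in the real variables $x=(f,w,\hat y,\overline y)$, with $f\in\mathbb{R}^{A\times S(l)}$, $w\in\mathbb{R}^{V\times P(l)}$ and $\hat y,\overline y\in\mathbb{R}^{V\times S(l)}$: \begin{align*} \sum_{a\in\delta^+(i)}f_a^s-\sum_{a\in\delta^-(i)}f_a^s&=\hat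 y_i^s-\overline y_i^s && \forall i\in V,\ s\in S(l),\\ w_i^{p}&=\overline y_i^s && \forall i\in V,\ s\in S(l) \text{ with } |s|\ge 2,\ p=P_l(s),\\ w_i^{p}&=\hat y_i^s && \forall i\in V,\ p\in P(l),\ s\in p,\\ \sum_{i\in V}w_i^p&=1 && \forall p\in P(l),\\ \hat y_r^K=1,\qquad \hat y_i^K&=0 && \forall i\in V\setminus\{r\},\\ \overline y_{t_k}^{\{k\}}=1,\qquad \overline y_i^{\{k\}}&=0 && \forall k\in K,\ i\in V\setminus\{t_k\}. \end{align*} Let $\mathcal{Q}_l^{IP}$ be the set of solutions all of whose entries lie in $\{0,1\}$, and let $\mathcal{Q}_l^{LP}$ be the set of solutions all of whose entries lie in the interval $[0,1]$. Then $$\operatorname{Conv}(\mathcal{Q}_l^{IP})=\mathcal{Q}_l^{LP}.$$ -/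

import Mathlib

namespace SteinerLP

variable {V K : Type*} [Fintype V] [DecidableEq V] [Fintype K] [DecidableEq K]

/-- Laminar families of nonempty subsets of the commodity set `K` which contain `K` itself and
all singletons. -/
structure IsLaminarFamily (l : Finset (Finset K)) : Prop where
  nonempty_of_mem : ∀ s ∈ l, s.Nonempty
  univ_mem : Finset.univ ∈ l
  singleton_mem : ∀ k : K, {k} ∈ l
  laminar : ∀ s ∈ l, ∀ s' ∈ l, s ⊆ s' ∨ s' ⊆ s ∨ Disjoint s s'

/-- The child sets of `s` in `l`: the maximal members of `l` properly contained in `s`. They are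
the blocks of the partition that splits `s`, so this finset is also the partition `P_l(s)`. -/
def children (l : Finset (Finset K)) (s : Finset K) : Finset (Finset K) :=
  {s' ∈ l | s' ⊂ s ∧ ∀ u ∈ l, u ⊂ s → s' ⊆ u → u = s'}

/-- `P(l)`: the partitions used to split the members of `l` that have at least two elements. -/
def partitions (l : Finset (Finset K)) : Finset (Finset (Finset K)) :=
  {s ∈ l | 2 ≤ s.card}.image (children l)

/-- `δ⁺(i)`: the arcs leaving `i`. The arcs are the darts of `G`, two opposite ones per edge. -/
def outArcs (G : SimpleGraph V) [DecidableRel G.Adj] (i : V) : Finset G.Dart :=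
  {a | a.fst = i}

/-- `δ⁻(i)`: the arcs entering `i`. -/
def inArcs (G : SimpleGraph V) [DecidableRel G.Adj] (i : V) : Finset G.Dart :=
  {a | a.snd = i}

/-- The space of the vectors `x = (f, w, ŷ, ȳ)`, with the entries `f a s`, `w i p`, `ŷ i s` and
`ȳ i s` for arcs `a`, nodes `i`, sets `s ∈ S(l)` and partitions `p ∈ P(l)`. -/
abbrev Point (G : SimpleGraph V) (l : Finset (Finset K)) : Type _ :=
  (G.Dart → l → ℝ) × (V → partitions l → ℝ) × (V → l → ℝ) × (V → l → ℝ)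

section Coordinates

variable {G : SimpleGraph V} {l : Finset (Finset K)}

/-- The flow variables `f`. -/
def Point.f (x : Point G l) : G.Dart → l → ℝ := x.1

/-- The splitting variables `w`. -/
def Point.w (x : Point G l) : V → partitions l → ℝ := x.2.1

/-- The variables `ŷ`: where a set starts sharing a path. -/
def Point.yStart (x : Point G l) : V → l → ℝ := x.2.2.1

/-- The variables `ȳ`: where a set ends sharing a path. -/
def Point.yEnd (x : Point G l) : V → l → ℝ := x.2.2.2

end Coordinates

/-- The linear equations common to the integer program and its LP relaxation, for the graph `G`,
the root `r`, the sinks `t` and the family `l`. -/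
structure LinearConstraints (G : SimpleGraph V) [DecidableRel G.Adj] (r : V) (t : K → V)
    (l : Finset (Finset K)) (x : Point G l) : Prop where
  flow : ∀ (i : V) (s : l),
    ∑ a ∈ outArcs G i, Point.f x a s - ∑ a ∈ inArcs G i, Point.f x a s =
      Point.yStart x i s - Point.yEnd x i s
  split_parent : ∀ (i : V) (s : l) (p : partitions l),
    2 ≤ s.val.card → p.val = children l s.val → Point.w x i p = Point.yEnd x i s
  split_child : ∀ (i : V) (p : partitions l) (s : l),
    s.val ∈ p.val → Point.w x i p = Point.yStart x i s
  split_once : ∀ p : partitions l, ∑ i : V, Point.w x i p = 1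
  start_root : ∀ s : l, s.val = Finset.univ → Point.yStart x r s = 1
  start_other : ∀ s : l, s.val = Finset.univ → ∀ i : V, i ≠ r → Point.yStart x i s = 0
  end_sink : ∀ (k : K) (s : l), s.val = {k} → Point.yEnd x (t k) s = 1
  end_other : ∀ (k : K) (s : l), s.val = {k} → ∀ i : V, i ≠ t k → Point.yEnd x i s = 0

/-- All the variables take values in the set `B` of reals. -/
def ValuesIn (G : SimpleGraph V) (l : Finset (Finset K)) (B : Set ℝ) (x : Point G l) : Prop :=
  (∀ a s, Point.f x a s ∈ B) ∧ (∀ i p, Point.w x i p ∈ B) ∧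
    (∀ i s, Point.yStart x i s ∈ B) ∧ (∀ i s, Point.yEnd x i s ∈ B)

/-- The feasible region of the integer program. -/
def QIP (G : SimpleGraph V) [DecidableRel G.Adj] (r : V) (t : K → V) (l : Finset (Finset K)) :
    Set (Point G l) :=
  {x | LinearConstraints G r t l x ∧ ValuesIn G l {0, 1} x}

/-- The feasible region of the LP relaxation. -/
def QLP (G : SimpleGraph V) [DecidableRel G.Adj] (r : V) (t : K → V) (l : Finset (Finset K)) :
    Set (Point G l) :=
  {x | LinearConstraints G r t l x ∧ ValuesIn G l (Set.Icc 0 1) x}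

end SteinerLP

/-!
For a fixed set `s` of the laminar family, the variables `f^s`, `ŷ^s`, `ȳ^s` form a flow of one
unit from the distribution `ŷ^s` to the distribution `ȳ^s`, and the sets interact only through the
equations that make a set start where its parent ends. The family is a tree under the parent
relation, and the linking equations only ask two adjacent sets to have the same marginal
distribution of a node. So the polytopes of the single sets, which are integral, can be glued along
the tree without losing integrality, in the way a tree-indexed Markov chain is built from its
pairwise marginals.

* `mem_convexHull_isRounding`: a network flow with integral divergences is a convex combination of
  its integral roundings with the same divergences. By the Krein–Milman theorem it is enough that
  extreme points are integral. Otherwise the edges with fractional values touch every node at least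
  twice or not at all, so by a dimension count they carry a circulation, along which the flow can be
  moved in both directions. Rounding keeps integral entries, so the equations at the root and at the
  terminals survive.
* `mk_mem_convexHull_of_label_eq`: two convex combinations whose points carry labels with the same
  distribution can be coupled so that only points with equal labels are paired.
* `mem_convexHull_linkedRoundings`: the induction over the laminar tree, which attaches one set at a
  time to its parent, the label being the node at which the parent ends.

The splitting variables `w` are copies of entries of `ȳ`, so the decomposition of the blocks
`(f^s, ŷ^s, ȳ^s)` is carried over to the whole vector by a linear map.
-/

namespace SteinerLP

/-! ### Integrality of network flows -/

section Rounding

variable {N E : Type*} [DecidableEq N] [Fintype E]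

/-- The net flow out of the node `n` of a network, for the edge values `y`. -/
def divergence (tail head : E → N) (y : E → ℝ) (n : N) : ℝ :=
  ∑ e, ((if tail e = n then y e else 0) - (if head e = n then y e else 0))

/-- `y` arises from `x` by rounding every entry up or down; integral entries do not change. -/
def IsRounding {ι : Type*} (x y : ι → ℝ) : Prop :=
  ∀ i, y i = ⌊x i⌋ ∨ y i = ⌈x i⌉

theorem divergence_add_smul (tail head : E → N) (y d : E → ℝ) (c : ℝ) (n : N) :
    divergence tail head (y + c • d) n =
      divergence tail head y n + c * divergence tail head d n := by
  simp only [divergence, Finset.mul_sum, ← Finset.sum_add_distrib]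
  refine Finset.sum_congr rfl fun e _ => ?_
  simp only [Pi.add_apply, Pi.smul_apply, smul_eq_mul]
  split_ifs <;> ring

theorem sum_divergence [Fintype N] (tail head : E → N) (y : E → ℝ) :
    ∑ n, divergence tail head y n = 0 := by
  simp only [divergence]
  rw [Finset.sum_comm]
  simp

/-- If all edge values but one are integral at a node with integral divergence, so is that one. -/
theorem exists_other_fractional {tail head : E → N} (hloop : ∀ e, tail e ≠ head e) {y : E → ℝ}
    {n : N} {z : ℤ} (hz : divergence tail head y n = z) {e : E} (he : tail e = n ∨ head e = n)
    (hfrac : ∀ m : ℤ, y e ≠ m) :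
    ∃ e', e' ≠ e ∧ (tail e' = n ∨ head e' = n) ∧ ∀ m : ℤ, y e' ≠ m := by
  classical
  by_contra! hcon
  have hint : ∀ e', e' ≠ e → ∃ m : ℤ,
      ((if tail e' = n then y e' else 0) - (if head e' = n then y e' else 0)) = m := by
    intro e' hne
    by_cases h : tail e' = n ∨ head e' = n
    · obtain ⟨m, hm⟩ := hcon e' hne h
      refine ⟨(if tail e' = n then m else 0) - (if head e' = n then m else 0), ?_⟩
      rw [hm]
      push_cast
      rfl
    · push Not at h
      exact ⟨0, by simp [h.1, h.2]⟩
  choose! g hg using hint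
  rw [divergence, ← Finset.add_sum_erase _ _ (Finset.mem_univ e),
    Finset.sum_congr rfl (fun e' he' => hg e' (Finset.ne_of_mem_erase he')), ← Int.cast_sum] at hz
  rcases he with h | h
  · rw [if_pos h, if_neg (fun h' => hloop e (h.trans h'.symm))] at hz
    exact hfrac (z - ∑ e' ∈ Finset.univ.erase e, g e') (by push_cast at hz ⊢; linarith)
  · rw [if_pos h, if_neg (fun h' => hloop e (h'.trans h.symm))] at hz
    exact hfrac (∑ e' ∈ Finset.univ.erase e, g e' - z) (by push_cast at hz ⊢; linarith)

/-- A nonempty set `F` of edges without vertices of degree one carries a nonzero circulation: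
there are at most as many touched nodes as edges, and the divergence takes its values in the
proper subspace of vectors with sum zero. -/
theorem exists_circulation [Fintype N] {tail head : E → N} (F : Finset E)
    (hF : F.Nonempty)
    (hdeg : ∀ e ∈ F, ∀ n, tail e = n ∨ head e = n →
      ∃ e' ∈ F, e' ≠ e ∧ (tail e' = n ∨ head e' = n)) :
    ∃ d : E → ℝ, d ≠ 0 ∧ (∀ e ∉ F, d e = 0) ∧ ∀ n, divergence tail head d n = 0 := by
  classical
  set W : Finset N := F.image tail ∪ F.image head with hW
  have memW : ∀ n, n ∈ W ↔ ∃ e ∈ F, tail e = n ∨ head e = n := by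
    intro n
    simp only [hW, Finset.mem_union, Finset.mem_image]
    grind
  have hcard : W.card ≤ F.card := by
    have h1 : ∀ n ∈ W, 2 ≤
        (Finset.bipartiteBelow (fun e n => tail e = n ∨ head e = n) F n).card := by
      intro n hn
      obtain ⟨e, he, hen⟩ := (memW n).1 hn
      obtain ⟨e', he', hne, hen'⟩ := hdeg e he n hen
      exact Finset.one_lt_card.2 ⟨e', by simp [Finset.bipartiteBelow, he', hen'], e,
        by simp [Finset.bipartiteBelow, he, hen], hne⟩
    have h2 : ∀ e ∈ F,
        (Finset.bipartiteAbove (fun e n => tail e = n ∨ head e = n) W e).card ≤ 2 := by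
      intro e _
      refine (Finset.card_le_card (t := {tail e, head e}) ?_).trans Finset.card_le_two
      intro n hn
      simp only [Finset.bipartiteAbove, Finset.mem_filter] at hn
      simp only [Finset.mem_insert, Finset.mem_singleton]
      grind
    have := Finset.card_mul_le_card_mul' (fun e n => tail e = n ∨ head e = n) h1 h2
    omega
  -- Extension by zero, followed by the divergence at the touched nodes.
  let ext : (F → ℝ) → E → ℝ := fun d e => if h : e ∈ F then d ⟨e, h⟩ else 0
  have hext : ∀ d : F → ℝ, ∀ n ∉ W, divergence tail head (ext d) n = 0 := by
    intro d n hn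
    refine Finset.sum_eq_zero fun e _ => ?_
    by_cases he : e ∈ F
    · have ht : tail e ≠ n := fun h => hn ((memW n).2 ⟨e, he, .inl h⟩)
      have hh : head e ≠ n := fun h => hn ((memW n).2 ⟨e, he, .inr h⟩)
      simp [ht, hh]
    · simp [ext, he]
  have hlin : ∀ (d d' : F → ℝ) (c : ℝ), ext (d + c • d') = ext d + c • ext d' := by
    intro d d' c
    funext e
    by_cases he : e ∈ F <;> simp [ext, he]
  have hext0 : ext 0 = 0 := by
    funext e
    simp [ext]
  have hdiv0 : ∀ n, divergence tail head (0 : E → ℝ) n = 0 := fun n => by simp [divergence]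
  let D : (F → ℝ) →ₗ[ℝ] (W → ℝ) :=
    { toFun := fun d n => divergence tail head (ext d) n
      map_add' := fun d d' => by
        funext n
        have := hlin d d' 1
        rw [one_smul, one_smul] at this
        simp only [this, Pi.add_apply]
        simpa using divergence_add_smul tail head (ext d) (ext d') 1 n
      map_smul' := fun c d => by
        funext n
        have := hlin 0 d c
        rw [zero_add, hext0, zero_add] at this
        simp only [this, Pi.smul_apply, RingHom.id_apply, smul_eq_mul]
        simpa [hdiv0] using divergence_add_smul tail head 0 (ext d) c n }
  have hninj : ¬ Function.Injective D := by
    intro hinj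
    have hle : F.card ≤ W.card := by
      simpa using LinearMap.finrank_le_finrank_of_injective hinj
    have heq : Module.finrank ℝ (F → ℝ) = Module.finrank ℝ (W → ℝ) := by
      simpa using le_antisymm hle hcard
    have hsurj := (LinearMap.injective_iff_surjective_of_finrank_eq_finrank heq).1 hinj
    obtain ⟨e, he⟩ := hF
    obtain ⟨d, hd⟩ := hsurj fun _ => 1
    have hsum : ∑ n ∈ W, divergence tail head (ext d) n = 0 := by
      rw [← sum_divergence tail head (ext d)]
      exact Finset.sum_subset (Finset.subset_univ _) fun n _ hn => hext d n hn
    have hone : ∀ n ∈ W, divergence tail head (ext d) n = 1 := fun n hn =>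
      congrFun hd ⟨n, hn⟩
    rw [Finset.sum_congr rfl hone] at hsum
    have : W = ∅ := by simpa using hsum
    exact Finset.notMem_empty _ (this ▸ (memW (tail e)).2 ⟨e, he, .inl rfl⟩)
  rw [← LinearMap.ker_eq_bot] at hninj
  obtain ⟨d, hd, hne⟩ := (Submodule.ne_bot_iff _).1 hninj
  refine ⟨ext d, ?_, fun e he => by simp [ext, he], fun n => ?_⟩
  · obtain ⟨e, he⟩ := Function.ne_iff.1 hne
    exact Function.ne_iff.2 ⟨e, by simpa [ext] using he⟩
  · by_cases hn : n ∈ W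
    · exact congrFun (LinearMap.mem_ker.1 hd) ⟨n, hn⟩
    · exact hext d n hn

/-- Integrality of network flows: edge values with integral divergences form a convex combination
of roundings with the same divergences. -/
theorem mem_convexHull_isRounding [Fintype N] {tail head : E → N}
    (hloop : ∀ e, tail e ≠ head e) (x : E → ℝ)
    (hx : ∀ n, ∃ z : ℤ, divergence tail head x n = z) :
    x ∈ convexHull ℝ {y | IsRounding x y ∧ ∀ n, divergence tail head y n =
      divergence tail head x n} := by
  classical
  set I : Set (E → ℝ) := {y | IsRounding x y ∧ ∀ n, divergence tail head y n =
    divergence tail head x n} with hI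
  let P : Set (E → ℝ) := (Set.univ.pi fun e => Set.Icc (⌊x e⌋ : ℝ) ⌈x e⌉) ∩
    {y | ∀ n, divergence tail head y n = divergence tail head x n}
  have hPx : x ∈ P := ⟨fun e _ => ⟨Int.floor_le _, Int.le_ceil _⟩, fun _ => rfl⟩
  have hcont : ∀ n, Continuous fun y : E → ℝ => divergence tail head y n := by
    intro n
    unfold divergence
    refine continuous_finsetSum _ fun e _ => Continuous.sub ?_ ?_ <;> split_ifs <;> fun_prop
  have hclosed : IsClosed {y : E → ℝ | ∀ n, divergence tail head y n =
      divergence tail head x n} := by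
    rw [Set.ofPred_forall]
    exact isClosed_iInter fun n => isClosed_eq (hcont n) continuous_const
  have hcompact : IsCompact P :=
    (isCompact_univ_pi fun e => isCompact_Icc).inter_right hclosed
  have hconvex : Convex ℝ P := by
    refine (convex_pi fun e _ => convex_Icc _ _).inter ?_
    intro y hy z hz a b _ _ hab n
    have h1 := divergence_add_smul tail head (a • y) z b n
    have h2 := divergence_add_smul tail head 0 y a n
    have h0 : divergence tail head (0 : E → ℝ) n = 0 := by simp [divergence]
    rw [zero_add, h0] at h2
    rw [h1, h2, hy n, hz n, zero_add, ← add_mul, hab, one_mul]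
  have hfin : I.Finite := by
    refine (Set.Finite.pi fun e => Set.toFinite ({(⌊x e⌋ : ℝ), (⌈x e⌉ : ℝ)} : Set ℝ)).subset ?_
    intro y hy e _
    exact hy.1 e
  have hext : P.extremePoints ℝ ⊆ I := by
    intro y hy
    obtain ⟨⟨hbox, hdiv⟩, hyext⟩ := mem_extremePoints.1 hy
    refine ⟨?_, hdiv⟩
    by_contra hround
    let F : Finset E := Finset.univ.filter fun e => (⌊x e⌋ : ℝ) < y e ∧ y e < ⌈x e⌉
    have memF : ∀ e, e ∈ F ↔ (⌊x e⌋ : ℝ) < y e ∧ y e < ⌈x e⌉ := fun e => by simp [F]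
    have hFint : ∀ e ∈ F, ∀ m : ℤ, y e ≠ m := by
      intro e he m hm
      obtain ⟨h1, h2⟩ := (memF e).1 he
      rw [hm] at h1 h2
      have h1 : ⌊x e⌋ < m := by exact_mod_cast h1
      have h2 : m < ⌈x e⌉ := by exact_mod_cast h2
      have := Int.ceil_le_floor_add_one (x e)
      omega
    have hnotF : ∀ e ∉ F, y e = ⌊x e⌋ ∨ y e = ⌈x e⌉ := by
      intro e he
      have h1 := (hbox e trivial).1
      have h2 := (hbox e trivial).2
      by_contra! h
      exact he ((memF e).2 ⟨lt_of_le_of_ne h1 h.1.symm, lt_of_le_of_ne h2 h.2⟩)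
    have hFne : F.Nonempty := by
      rw [Finset.nonempty_iff_ne_empty]
      intro h
      exact hround fun e => hnotF e (h ▸ Finset.notMem_empty e)
    obtain ⟨d, hd0, hdF, hdd⟩ := exists_circulation F hFne (by
      intro e he n hen
      obtain ⟨z, hz⟩ := hx n
      obtain ⟨e', hne, hen', hfr⟩ := exists_other_fractional hloop ((hdiv n).trans hz) hen
        (hFint e he)
      refine ⟨e', ?_, hne, hen'⟩
      by_contra h
      rcases hnotF e' h with h | h
      exacts [hfr _ h, hfr _ h])
    -- A common step length that keeps every fractional entry between its bounds.
    have hstep : ∀ᶠ c in nhds (0 : ℝ), ∀ e, (y + c • d) e ∈ Set.Icc (⌊x e⌋ : ℝ) ⌈x e⌉ := by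
      rw [Filter.eventually_all]
      intro e
      by_cases he : e ∈ F
      · obtain ⟨h1, h2⟩ := (memF e).1 he
        have hc : Filter.Tendsto (fun c : ℝ => (y + c • d) e) (nhds 0) (nhds (y e)) := by
          have : Continuous fun c : ℝ => (y + c • d) e := by
            simp only [Pi.add_apply, Pi.smul_apply, smul_eq_mul]
            fun_prop
          simpa using this.tendsto 0
        exact hc (Icc_mem_nhds h1 h2)
      · refine Filter.Eventually.of_forall fun c => ?_
        simpa [hdF e he] using hbox e trivial
    obtain ⟨ε, hε, hball⟩ := Metric.eventually_nhds_iff.1 hstep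
    have hmem : ∀ c : ℝ, |c| < ε → y + c • d ∈ P := fun c hc =>
      ⟨fun e _ => hball (by simpa using hc) e, fun n => by
        rw [divergence_add_smul, hdd, mul_zero, add_zero, hdiv n]⟩
    have hy1 := hyext _ (hmem (ε / 2) (by rw [abs_of_pos (by linarith)]; linarith))
      _ (hmem (-(ε / 2)) (by rw [abs_neg, abs_of_pos (by linarith)]; linarith))
      ⟨1 / 2, 1 / 2, by norm_num, by norm_num, by norm_num, by
        funext e
        simp only [Pi.add_apply, Pi.smul_apply, smul_eq_mul]
        ring⟩
    apply hd0
    have h3 : (ε / 2) • d = 0 := by simpa using hy1.1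
    exact (smul_eq_zero.1 h3).resolve_left (by linarith)
  have hKM := closure_convexHull_extremePoints hcompact hconvex
  rw [← hKM] at hPx
  exact closure_minimal (convexHull_mono hext) (hfin.isClosed_convexHull ℝ) hPx

end Rounding

/-! ### Coupling convex combinations with a common label -/

section FiberProduct

variable {V E F : Type*} [DecidableEq V] [AddCommGroup E] [Module ℝ E]
  [AddCommGroup F] [Module ℝ F]

/-- Convex combinations of points of `A` and of `B` with the same marginal distribution of a label
in `V` have a coupling on the pairs with equal labels. The label of a point is encoded as the unit
vector that a linear map assigns to it; the coupling makes the two sides independent given the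
label. -/
theorem mk_mem_convexHull_of_label_eq (L : E →ₗ[ℝ] V → ℝ) (M : F →ₗ[ℝ] V → ℝ) {A : Set E}
    {B : Set F} (hA : ∀ a ∈ A, ∃ v, L a = Pi.single v 1) (hB : ∀ b ∈ B, ∃ v, M b = Pi.single v 1)
    {m : E} {n : F} (hm : m ∈ convexHull ℝ A) (hn : n ∈ convexHull ℝ B) (h : L m = M n) :
    (m, n) ∈ convexHull ℝ {q : E × F | q.1 ∈ A ∧ q.2 ∈ B ∧ L q.1 = M q.2} := by
  classical
  obtain ⟨ι, _, α, a, hα, hα1, ha, rfl⟩ := mem_convexHull_iff_exists_fintype.1 hm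
  obtain ⟨κ, _, β, b, hβ, hβ1, hb, rfl⟩ := mem_convexHull_iff_exists_fintype.1 hn
  choose p hp using fun i => hA (a i) (ha i)
  choose q hq using fun j => hB (b j) (hb j)
  set c : V → ℝ := L (∑ i, α i • a i) with hc
  have hcα : ∀ v, c v = ∑ i, if p i = v then α i else 0 := by
    intro v
    simp only [hc, map_sum, map_smul, Finset.sum_apply, Pi.smul_apply, hp, Pi.single_apply,
      smul_eq_mul, mul_ite, mul_one, mul_zero, eq_comm]
  have hcβ : ∀ v, c v = ∑ j, if q j = v then β j else 0 := by
    intro v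
    simp only [h, map_sum, map_smul, Finset.sum_apply, Pi.smul_apply, hq, Pi.single_apply,
      smul_eq_mul, mul_ite, mul_one, mul_zero, eq_comm]
  have hαc : ∀ i, α i ≤ c (p i) := by
    intro i
    rw [hcα]
    refine le_trans (by simp) (Finset.single_le_sum (f := fun i' => if p i' = p i then α i' else 0)
      (fun i' _ => ?_) (Finset.mem_univ i))
    split_ifs
    exacts [hα i', le_rfl]
  have hβc : ∀ j, β j ≤ c (q j) := by
    intro j
    rw [hcβ]
    refine le_trans (by simp) (Finset.single_le_sum (f := fun i' => if q i' = q j then β i' else 0)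
      (fun i' _ => ?_) (Finset.mem_univ j))
    split_ifs
    exacts [hβ _, le_rfl]
  let ω : ι → κ → ℝ := fun i j => if p i = q j then α i * β j / c (p i) else 0
  have hrow : ∀ i, ∑ j, ω i j = α i := by
    intro i
    have : ∑ j, ω i j = α i / c (p i) * c (p i) := by
      rw [hcβ (p i), Finset.mul_sum, ← hcβ]
      refine Finset.sum_congr rfl fun j _ => ?_
      simp only [ω, eq_comm (a := p i)]
      split_ifs <;> ring
    rw [this]
    rcases eq_or_ne (c (p i)) 0 with h0 | h0
    · have := hαc i
      rw [h0] at this ⊢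
      rw [mul_zero, le_antisymm this (hα i)]
    · exact div_mul_cancel₀ _ h0
  have hcol : ∀ j, ∑ i, ω i j = β j := by
    intro j
    have : ∑ i, ω i j = β j / c (q j) * c (q j) := by
      rw [hcα (q j), Finset.mul_sum, ← hcα]
      refine Finset.sum_congr rfl fun i _ => ?_
      simp only [ω]
      split_ifs with h
      · rw [h]; ring
      · ring
    rw [this]
    rcases eq_or_ne (c (q j)) 0 with h0 | h0
    · have := hβc j
      rw [h0] at this ⊢
      rw [mul_zero, le_antisymm this (hβ j)]
    · exact div_mul_cancel₀ _ h0
  have hω : ∀ i j, 0 ≤ ω i j := by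
    intro i j
    simp only [ω]
    split_ifs
    · exact div_nonneg (mul_nonneg (hα i) (hβ j)) ((hα i).trans (hαc i))
    · exact le_rfl
  have hzero : ∀ k : ι × κ, ω k.1 k.2 ≠ 0 → p k.1 = q k.2 := by
    intro k hk
    by_contra hne
    exact hk (by simp [ω, hne])
  have hmem := (convex_convexHull ℝ {q : E × F | q.1 ∈ A ∧ q.2 ∈ B ∧ L q.1 = M q.2}).sum_mem
    (t := Finset.univ.filter fun k : ι × κ => p k.1 = q k.2) (w := fun k => ω k.1 k.2)
    (z := fun k => (a k.1, b k.2)) (fun k _ => hω _ _)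
    (by
      rw [Finset.sum_filter_of_ne fun k _ => hzero k, Fintype.sum_prod_type]
      simp only [hrow, hα1])
    (fun k hk => subset_convexHull ℝ _ ⟨ha _, hb _, by
      simp only [hp, hq, (Finset.mem_filter.1 hk).2]⟩)
  rw [Finset.sum_filter_of_ne fun k _ hk => hzero k fun h0 => hk (by rw [h0, zero_smul])] at hmem
  convert hmem using 1
  refine Prod.ext ?_ ?_
  · simp only [Prod.fst_sum, Prod.smul_fst, Fintype.sum_prod_type, ← Finset.sum_smul, hrow]
  · simp only [Prod.snd_sum, Prod.smul_snd, Fintype.sum_prod_type_right, ← Finset.sum_smul, hcol]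

end FiberProduct

/-! ### Unit flows of a single set of commodities -/

section UnitFlow

variable {V : Type*} [Fintype V] [DecidableEq V]

/-- The variables that belong to a single set `s` of the laminar family: the flow `f^s` and the
vectors `ŷ^s` and `ȳ^s` of its supplies and demands. -/
abbrev Block (G : SimpleGraph V) : Type _ :=
  (G.Dart → ℝ) × (V → ℝ) × (V → ℝ)

/-- The flow of the block ships one unit from its start vector to its end vector. -/
structure IsUnitFlow (G : SimpleGraph V) [DecidableRel G.Adj] (b : Block G) : Prop where
  flow : ∀ i, ∑ a ∈ outArcs G i, b.1 a - ∑ a ∈ inArcs G i, b.1 a = b.2.1 i - b.2.2 i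
  sum_start : ∑ i, b.2.1 i = 1
  sum_end : ∑ i, b.2.2 i = 1

/-- The unit flows that arise from the block `b` by rounding all of its entries. -/
def unitFlowRoundings (G : SimpleGraph V) [DecidableRel G.Adj] (b : Block G) : Set (Block G) :=
  {c | IsUnitFlow G c ∧ IsRounding b.1 c.1 ∧ IsRounding b.2.1 c.2.1 ∧ IsRounding b.2.2 c.2.2}

/-- Supplies and demands become arcs out of an artificial source and into an artificial sink, so
the integrality of network flows applies to unit flows. -/
theorem IsUnitFlow.mem_convexHull_roundings {G : SimpleGraph V} [DecidableRel G.Adj] {b : Block G}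
    (hb : IsUnitFlow G b) : b ∈ convexHull ℝ (unitFlowRoundings G b) := by
  let tail : G.Dart ⊕ V ⊕ V → V ⊕ Bool :=
    Sum.elim (fun a => .inl a.fst) (Sum.elim (fun _ => .inr false) (fun i => .inl i))
  let head : G.Dart ⊕ V ⊕ V → V ⊕ Bool :=
    Sum.elim (fun a => .inl a.snd) (Sum.elim (fun i => .inl i) (fun _ => .inr true))
  have hloop : ∀ e, tail e ≠ head e := by
    rintro (a | i | i)
    · simp [tail, head]
    · simp [tail, head]
    · simp [tail, head]
  have hnode : ∀ (y : G.Dart ⊕ V ⊕ V → ℝ) (i : V), divergence tail head y (.inl i) =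
      ∑ a ∈ outArcs G i, y (.inl a) - ∑ a ∈ inArcs G i, y (.inl a) -
        (y (.inr (.inl i)) - y (.inr (.inr i))) := by
    intro y i
    simp only [divergence, tail, head, outArcs, inArcs, Fintype.sum_sum_type, Sum.elim_inl,
      Sum.elim_inr, Sum.inl.injEq, reduceCtorEq, if_false, Finset.sum_sub_distrib,
      Finset.sum_filter, Finset.sum_ite_eq', Finset.mem_univ, if_true, Finset.sum_const_zero]
    ring
  have hsource : ∀ y : G.Dart ⊕ V ⊕ V → ℝ, divergence tail head y (.inr false) =
      ∑ i, y (.inr (.inl i)) := by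
    intro y
    simp [divergence, tail, head, Fintype.sum_sum_type]
  have hsink : ∀ y : G.Dart ⊕ V ⊕ V → ℝ, divergence tail head y (.inr true) =
      -∑ i, y (.inr (.inr i)) := by
    intro y
    simp [divergence, tail, head, Fintype.sum_sum_type]
  let x : G.Dart ⊕ V ⊕ V → ℝ := Sum.elim b.1 (Sum.elim b.2.1 b.2.2)
  have hxnode : ∀ i, divergence tail head x (.inl i) = 0 := fun i => by
    rw [hnode]
    exact sub_eq_zero.2 (hb.flow i)
  have hxsource : divergence tail head x (.inr false) = 1 := (hsource x).trans hb.sum_start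
  have hxsink : divergence tail head x (.inr true) = -1 :=
    (hsink x).trans (congrArg Neg.neg hb.sum_end)
  have hx := mem_convexHull_isRounding hloop x (by
    rintro (i | _ | _)
    exacts [⟨0, by rw [hxnode, Int.cast_zero]⟩, ⟨1, by rw [hxsource, Int.cast_one]⟩,
      ⟨-1, by rw [hxsink]; norm_num⟩])
  let φ : (G.Dart ⊕ V ⊕ V → ℝ) →ₗ[ℝ] Block G :=
    { toFun := fun y => (fun a => y (.inl a), fun i => y (.inr (.inl i)),
        fun i => y (.inr (.inr i)))
      map_add' := fun _ _ => rfl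
      map_smul' := fun _ _ => rfl }
  have hφ := Set.mem_image_of_mem φ hx
  rw [φ.image_convexHull] at hφ
  refine convexHull_mono ?_ hφ
  rintro _ ⟨y, ⟨hround, hdiv⟩, rfl⟩
  refine ⟨⟨fun i => sub_eq_zero.1 ?_, ?_, ?_⟩, fun a => hround _, fun i => hround _,
    fun i => hround _⟩
  · rw [← hxnode i, ← hdiv, hnode]
    rfl
  · rw [← hxsource, ← hdiv, hsource]
    rfl
  · rw [← neg_inj, ← hxsink, ← hdiv, hsink]
    rfl

theorem IsRounding.eq_zero_or_one {ι : Type*} {x y : ι → ℝ} (h : IsRounding x y) {i : ι}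
    (hx : x i ∈ Set.Icc (0 : ℝ) 1) : y i ∈ ({0, 1} : Set ℝ) := by
  rcases hx.2.lt_or_eq with h1 | h1
  · have hfloor : ⌊x i⌋ = 0 := Int.floor_eq_zero_iff.2 ⟨hx.1, h1⟩
    rcases h i with h | h
    · exact .inl (by rw [h, hfloor, Int.cast_zero])
    · rcases hx.1.lt_or_eq with h0 | h0
      · have hceil : ⌈x i⌉ = 1 := Int.ceil_eq_iff.2 ⟨by simpa using h0, by simpa using h1.le⟩
        exact .inr (by rw [h, hceil, Int.cast_one]; rfl)
      · exact .inl (by rw [h, ← h0]; simp)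
  · rcases h i with h | h <;> exact .inr (by rw [h, h1]; simp)

theorem IsRounding.eq_zero {ι : Type*} {x y : ι → ℝ} (h : IsRounding x y) {i : ι}
    (hx : x i = 0) : y i = 0 := by
  rcases h i with h | h <;> rw [h, hx] <;> simp

theorem IsRounding.eq_one {ι : Type*} {x y : ι → ℝ} (h : IsRounding x y) {i : ι}
    (hx : x i = 1) : y i = 1 := by
  rcases h i with h | h <;> rw [h, hx] <;> simp

/-- A vector with entries in `{0, 1}` that sum to one is a unit vector. -/
theorem exists_eq_single {c : V → ℝ} (h01 : ∀ i, c i ∈ ({0, 1} : Set ℝ)) (hsum : ∑ i, c i = 1) :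
    ∃ v, c = Pi.single v 1 := by
  have hne : ∃ v, c v ≠ 0 := by
    by_contra! h
    simp [h] at hsum
  obtain ⟨v, hv⟩ := hne
  have hv1 : c v = 1 := (h01 v).resolve_left hv
  refine ⟨v, ?_⟩
  rw [← Finset.add_sum_erase _ _ (Finset.mem_univ v), hv1] at hsum
  have h0 := (Finset.sum_eq_zero_iff_of_nonneg (s := Finset.univ.erase v) (f := c) fun i _ => by
    rcases h01 i with h | h <;> rw [h]
    exact zero_le_one).1 (by linarith)
  funext i
  rcases eq_or_ne i v with rfl | hi
  · simpa using hv1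
  · simpa [hi] using h0 i (Finset.mem_erase.2 ⟨hi, Finset.mem_univ i⟩)

end UnitFlow

/-! ### Parents in a laminar family -/

section Laminar

variable {K : Type*} [Fintype K] [DecidableEq K] {l : Finset (Finset K)}

theorem ssubset_of_mem_children {s u : Finset K} (h : s ∈ children l u) : s ⊂ u :=
  (Finset.mem_filter.1 h).2.1

theorem IsLaminarFamily.exists_mem_children (hl : IsLaminarFamily l) {s : Finset K} (hs : s ∈ l)
    (hne : s ≠ Finset.univ) : ∃ u ∈ l, s ∈ children l u := by
  obtain ⟨u, hu⟩ := Finset.exists_minimal (s := {u ∈ l | s ⊂ u})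
    ⟨Finset.univ, Finset.mem_filter.2 ⟨hl.univ_mem, Finset.ssubset_univ_iff.2 hne⟩⟩
  obtain ⟨hul, hsu⟩ := Finset.mem_filter.1 hu.1
  refine ⟨u, hul, Finset.mem_filter.2 ⟨hs, hsu, fun w hw hwu hsw => ?_⟩⟩
  by_contra hws
  exact hwu.2 (hu.2 (Finset.mem_filter.2 ⟨hw, hsw.ssubset_of_ne (Ne.symm hws)⟩) hwu.1)

theorem IsLaminarFamily.eq_of_mem_children (hl : IsLaminarFamily l) {s u u' : Finset K}
    (hu : u ∈ l) (hu' : u' ∈ l) (h : s ∈ children l u) (h' : s ∈ children l u') : u = u' := by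
  obtain ⟨hs, hsu, hmax⟩ := Finset.mem_filter.1 h
  obtain ⟨-, hsu', hmax'⟩ := Finset.mem_filter.1 h'
  by_contra hne
  rcases hl.laminar u hu u' hu' with hsub | hsub | hdisj
  · exact hsu.ne (hmax' u hu (hsub.ssubset_of_ne hne) hsu.1).symm
  · exact hsu'.ne (hmax u' hu' (hsub.ssubset_of_ne (Ne.symm hne)) hsu'.1).symm
  · obtain ⟨k, hk⟩ := hl.nonempty_of_mem s hs
    exact Finset.disjoint_left.1 hdisj (hsu.1 hk) (hsu'.1 hk)

theorem IsLaminarFamily.two_le_card (hl : IsLaminarFamily l) {s u : Finset K}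
    (h : s ∈ children l u) : 2 ≤ u.card := by
  have h1 := (hl.nonempty_of_mem s (Finset.mem_filter.1 h).1).card_pos
  have h2 := Finset.card_lt_card (ssubset_of_mem_children h)
  omega

theorem IsLaminarFamily.children_nonempty (hl : IsLaminarFamily l) {u : Finset K}
    (hcard : 2 ≤ u.card) : (children l u).Nonempty := by
  obtain ⟨k, hk⟩ : u.Nonempty := Finset.card_pos.1 (by omega)
  have hku : {k} ⊂ u := (Finset.singleton_subset_iff.2 hk).ssubset_of_ne fun h => by
    rw [← h, Finset.card_singleton] at hcard
    omega
  obtain ⟨s, hs⟩ := Finset.exists_maximal (s := {s ∈ l | s ⊂ u})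
    ⟨{k}, Finset.mem_filter.2 ⟨hl.singleton_mem k, hku⟩⟩
  obtain ⟨hsl, hsu⟩ := Finset.mem_filter.1 hs.1
  exact ⟨s, Finset.mem_filter.2 ⟨hsl, hsu, fun w hw hwu hsw =>
    (hs.2 (Finset.mem_filter.2 ⟨hw, hwu⟩) hsw).antisymm hsw⟩⟩

theorem IsLaminarFamily.children_injOn (hl : IsLaminarFamily l) {u u' : Finset K} (hu : u ∈ l)
    (hu' : u' ∈ l) (hcard : 2 ≤ u.card) (h : children l u = children l u') : u = u' := by
  obtain ⟨s, hs⟩ := hl.children_nonempty hcard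
  exact hl.eq_of_mem_children hu hu' hs (h ▸ hs)

/-- Every partition in `P(l)` is the partition of a member of `l`. -/
theorem exists_parent (p : partitions l) :
    ∃ u : l, 2 ≤ u.val.card ∧ p.val = children l u.val := by
  obtain ⟨u, hu, hp⟩ := Finset.mem_image.1 p.2
  exact ⟨⟨u, (Finset.mem_filter.1 hu).1⟩, (Finset.mem_filter.1 hu).2, hp.symm⟩

end Laminar

/-! ### Gluing along the laminar tree -/

section Gluing

variable {V K : Type*} [Fintype V] [DecidableEq V] [Fintype K] [DecidableEq K]
  {l : Finset (Finset K)} {G : SimpleGraph V} [DecidableRel G.Adj]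

/-- The families of blocks whose members in `T` are roundings of those of `e`, and where each set
in `T` starts its path at the node where its parent ends, if the parent is in `T`. Blocks outside
`T` are unconstrained. -/
def linkedRoundings (e : l → Block G) (T : Finset l) : Set (l → Block G) :=
  {z | ∀ s ∈ T, z s ∈ unitFlowRoundings G (e s) ∧
    ∀ u ∈ T, s.val ∈ children l u.val → (z s).2.1 = (z u).2.2}

/-- A family of unit flows that fit together along the laminar tree is a convex combination of
linked roundings. The sets are attached top-down: the decomposition of the larger sets and the one
of the new set are coupled along the node at which the parent splits. -/
theorem mem_convexHull_linkedRoundings (hl : IsLaminarFamily l) {e : l → Block G}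
    (hflow : ∀ s, IsUnitFlow G (e s)) (hstart : ∀ s i, (e s).2.1 i ∈ Set.Icc (0 : ℝ) 1)
    (hend : ∀ s i, (e s).2.2 i ∈ Set.Icc (0 : ℝ) 1)
    (hlink : ∀ s u : l, s.val ∈ children l u.val → (e s).2.1 = (e u).2.2) (T : Finset l)
    (hT : ∀ s ∈ T, ∀ u : l, s.val ∈ children l u.val → u ∈ T) :
    e ∈ convexHull ℝ (linkedRoundings e T) := by
  induction T using Finset.strongInduction with
  | H T ih =>
    rcases T.eq_empty_or_nonempty with rfl | hne
    · exact subset_convexHull ℝ _ fun s hs => absurd hs (Finset.notMem_empty s)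
    obtain ⟨s, hs⟩ := Finset.exists_minimal hne
    have hsT := hs.1
    -- By minimality no set in `T` has the parent `s`.
    have hnochild : ∀ s' ∈ T, s'.val ∉ children l s.val := fun s' hs' h =>
      (ssubset_of_mem_children h).2 (hs.2 hs' (ssubset_of_mem_children h).1)
    have hold := ih (T.erase s) (Finset.erase_ssubset hsT) fun s' hs' u hu => by
      have hs'T := Finset.mem_of_mem_erase hs'
      refine Finset.mem_erase.2 ⟨?_, hT s' hs'T u hu⟩
      rintro rfl
      exact hnochild s' hs'T hu
    have hnew := (hflow s).mem_convexHull_roundings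
    have hpair : (e, e s) ∈ convexHull ℝ {q : (l → Block G) × Block G |
        q.1 ∈ linkedRoundings e (T.erase s) ∧ q.2 ∈ unitFlowRoundings G (e s) ∧
          ∀ u : l, s.val ∈ children l u.val → q.2.2.1 = (q.1 u).2.2} := by
      by_cases hroot : s.val = Finset.univ
      · have hprod : (e, e s) ∈ convexHull ℝ
            (linkedRoundings e (T.erase s) ×ˢ unitFlowRoundings G (e s)) := by
          rw [convexHull_prod]
          exact ⟨hold, hnew⟩
        refine convexHull_mono ?_ hprod
        intro q hq
        refine ⟨hq.1, hq.2, fun u hu => ?_⟩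
        exact absurd (Finset.subset_univ u.val) (hroot ▸ (ssubset_of_mem_children hu).2)
      · obtain ⟨u, hul, hsu⟩ := hl.exists_mem_children s.2 hroot
        have huT : ⟨u, hul⟩ ∈ T.erase s := by
          refine Finset.mem_erase.2 ⟨?_, hT s hsT ⟨u, hul⟩ hsu⟩
          rintro rfl
          exact (ssubset_of_mem_children hsu).ne rfl
        let L : (l → Block G) →ₗ[ℝ] V → ℝ :=
          { toFun := fun z => (z ⟨u, hul⟩).2.2
            map_add' := fun _ _ => rfl
            map_smul' := fun _ _ => rfl }
        let M : Block G →ₗ[ℝ] V → ℝ :=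
          { toFun := fun b => b.2.1
            map_add' := fun _ _ => rfl
            map_smul' := fun _ _ => rfl }
        have hglue := mk_mem_convexHull_of_label_eq L M
          (fun z hz => by
            obtain ⟨hz, -, -, hround⟩ := (hz _ huT).1
            exact exists_eq_single (fun i => hround.eq_zero_or_one (hend _ i)) hz.sum_end)
          (fun b hb => by
            obtain ⟨hb, -, hround, -⟩ := hb
            exact exists_eq_single (fun i => hround.eq_zero_or_one (hstart _ i)) hb.sum_start)
          hold hnew (hlink s ⟨u, hul⟩ hsu).symm
        refine convexHull_mono ?_ hglue
        intro q hq
        refine ⟨hq.1, hq.2.1, fun u' hu' => ?_⟩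
        obtain rfl : u' = ⟨u, hul⟩ := Subtype.ext (hl.eq_of_mem_children u'.2 hul hu' hsu)
        exact hq.2.2.symm
    let U : (l → Block G) × Block G →ₗ[ℝ] l → Block G :=
      { toFun := fun q => Function.update q.1 s q.2
        map_add' := fun q q' => Function.update_add q.1 q'.1 s q.2 q'.2
        map_smul' := fun c q => Function.update_smul c q.1 s q.2 }
    have hU := Set.mem_image_of_mem U hpair
    rw [U.image_convexHull] at hU
    have hUe : U (e, e s) = e := Function.update_eq_self s e
    rw [hUe] at hU
    refine convexHull_mono ?_ hU
    rintro _ ⟨⟨z, b⟩, ⟨hz, hb, hzb⟩, rfl⟩ s' hs'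
    have hUs : U (z, b) s = b := Function.update_self ..
    have hUne : ∀ v, v ≠ s → U (z, b) v = z v := fun v hv => Function.update_of_ne hv ..
    rcases eq_or_ne s' s with rfl | hs's
    · rw [hUs]
      refine ⟨hb, fun u _ hsu => ?_⟩
      rw [hUne u (by rintro rfl; exact (ssubset_of_mem_children hsu).ne rfl)]
      exact hzb u hsu
    · rw [hUne s' hs's]
      have hz' := hz s' (Finset.mem_erase.2 ⟨hs's, hs'⟩)
      refine ⟨hz'.1, fun u hu hsu => ?_⟩
      have hus : u ≠ s := by
        rintro rfl
        exact hnochild s' hs' hsu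
      rw [hUne u hus]
      exact hz'.2 u (Finset.mem_erase.2 ⟨hus, hu⟩) hsu

/-- The blocks of a vector of the linear program. -/
def Point.blocks (x : Point G l) (s : l) : Block G :=
  (fun a => x.f a s, fun i => x.yStart i s, fun i => x.yEnd i s)

theorem LinearConstraints.sum_start {r : V} {t : K → V} {x : Point G l}
    (h : LinearConstraints G r t l x) (hl : IsLaminarFamily l) (s : l) :
    ∑ i, x.yStart i s = 1 := by
  by_cases hroot : s.val = Finset.univ
  · rw [Fintype.sum_eq_single r (h.start_other s hroot), h.start_root s hroot]
  · obtain ⟨u, hul, hsu⟩ := hl.exists_mem_children s.2 hroot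
    let p : partitions l := ⟨children l u, Finset.mem_image_of_mem _
      (Finset.mem_filter.2 ⟨hul, hl.two_le_card hsu⟩)⟩
    rw [← h.split_once p]
    exact Finset.sum_congr rfl fun i _ => (h.split_child i p s hsu).symm

theorem LinearConstraints.sum_end {r : V} {t : K → V} {x : Point G l}
    (h : LinearConstraints G r t l x) (hl : IsLaminarFamily l) (s : l) :
    ∑ i, x.yEnd i s = 1 := by
  by_cases hcard : 2 ≤ s.val.card
  · let p : partitions l := ⟨children l s, Finset.mem_image_of_mem _
      (Finset.mem_filter.2 ⟨s.2, hcard⟩)⟩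
    rw [← h.split_once p]
    exact Finset.sum_congr rfl fun i _ => (h.split_parent i s p hcard rfl).symm
  · have hpos := (hl.nonempty_of_mem s s.2).card_pos
    obtain ⟨k, hk⟩ := Finset.card_eq_one.1 (show s.val.card = 1 by omega)
    rw [Fintype.sum_eq_single (t k) (h.end_other k s hk), h.end_sink k s hk]

theorem LinearConstraints.blocks_link {r : V} {t : K → V} {x : Point G l}
    (h : LinearConstraints G r t l x) (hl : IsLaminarFamily l) {s u : l}
    (hsu : s.val ∈ children l u.val) : (x.blocks s).2.1 = (x.blocks u).2.2 := by
  have hcard := hl.two_le_card hsu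
  let p : partitions l := ⟨children l u, Finset.mem_image_of_mem _
    (Finset.mem_filter.2 ⟨u.2, hcard⟩)⟩
  funext i
  exact (h.split_child i p s hsu).symm.trans (h.split_parent i u p hcard rfl)

theorem convex_QLP (r : V) (t : K → V) (l : Finset (Finset K)) : Convex ℝ (QLP G r t l) := by
  rintro x ⟨hx, hx1, hx2, hx3, hx4⟩ y ⟨hy, hy1, hy2, hy3, hy4⟩ a b ha hb hab
  have hf : ∀ d s, (a • x + b • y).f d s = a * x.f d s + b * y.f d s := fun _ _ => rfl
  have hw : ∀ i p, (a • x + b • y).w i p = a * x.w i p + b * y.w i p := fun _ _ => rfl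
  have hys : ∀ i s, (a • x + b • y).yStart i s = a * x.yStart i s + b * y.yStart i s :=
    fun _ _ => rfl
  have hye : ∀ i s, (a • x + b • y).yEnd i s = a * x.yEnd i s + b * y.yEnd i s := fun _ _ => rfl
  refine ⟨⟨?_, ?_, ?_, ?_, ?_, ?_, ?_, ?_⟩, ?_, ?_, ?_, ?_⟩
  · intro i s
    simp only [hf, hys, hye, Finset.sum_add_distrib, ← Finset.mul_sum]
    linear_combination a * hx.flow i s + b * hy.flow i s
  · intro i s p hs hp
    rw [hw, hye, hx.split_parent i s p hs hp, hy.split_parent i s p hs hp]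
  · intro i p s hs
    rw [hw, hys, hx.split_child i p s hs, hy.split_child i p s hs]
  · intro p
    simp only [hw, Finset.sum_add_distrib, ← Finset.mul_sum]
    rw [hx.split_once, hy.split_once, mul_one, mul_one, hab]
  · intro s hs
    rw [hys, hx.start_root s hs, hy.start_root s hs, mul_one, mul_one, hab]
  · intro s hs i hi
    rw [hys, hx.start_other s hs i hi, hy.start_other s hs i hi, mul_zero, mul_zero, add_zero]
  · intro k s hs
    rw [hye, hx.end_sink k s hs, hy.end_sink k s hs, mul_one, mul_one, hab]
  · intro k s hs i hi
    rw [hye, hx.end_other k s hs i hi, hy.end_other k s hs i hi, mul_zero, mul_zero, add_zero]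
  · exact fun d s => convex_Icc (0 : ℝ) 1 (hx1 d s) (hy1 d s) ha hb hab
  · exact fun i p => convex_Icc (0 : ℝ) 1 (hx2 i p) (hy2 i p) ha hb hab
  · exact fun i s => convex_Icc (0 : ℝ) 1 (hx3 i s) (hy3 i s) ha hb hab
  · exact fun i s => convex_Icc (0 : ℝ) 1 (hx4 i s) (hy4 i s) ha hb hab

theorem QIP_subset_QLP (r : V) (t : K → V) (l : Finset (Finset K)) :
    QIP G r t l ⊆ QLP G r t l := by
  have h01 : ({0, 1} : Set ℝ) ⊆ Set.Icc 0 1 := by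
    rintro c (rfl | rfl) <;> norm_num
  rintro x ⟨hx, h1, h2, h3, h4⟩
  exact ⟨hx, fun d s => h01 (h1 d s), fun i p => h01 (h2 i p), fun i s => h01 (h3 i s),
    fun i s => h01 (h4 i s)⟩

theorem QLP_subset_convexHull_QIP {r : V} {t : K → V} (hl : IsLaminarFamily l) :
    QLP G r t l ⊆ convexHull ℝ (QIP G r t l) := by
  rintro x ⟨hx, hx1, -, hx3, hx4⟩
  have hblocks := mem_convexHull_linkedRoundings hl (e := x.blocks)
    (fun s => ⟨fun i => hx.flow i s, hx.sum_start hl s, hx.sum_end hl s⟩)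
    (fun s i => hx3 i s) (fun s i => hx4 i s) (fun s u => hx.blocks_link hl) Finset.univ
    (fun _ _ _ _ => Finset.mem_univ _)
  choose parent hcard hparent using exists_parent (l := l)
  -- The splitting variables of a partition repeat the end vector of the set that is partitioned.
  let Ψ : (l → Block G) →ₗ[ℝ] Point G l :=
    { toFun := fun z => (fun a s => (z s).1 a, fun i p => (z (parent p)).2.2 i,
        fun i s => (z s).2.1 i, fun i s => (z s).2.2 i)
      map_add' := fun _ _ => rfl
      map_smul' := fun _ _ => rfl }
  have hΨx : Ψ x.blocks = x := by
    refine Prod.ext rfl (Prod.ext ?_ rfl)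
    funext i p
    exact (hx.split_parent i (parent p) p (hcard p) (hparent p)).symm
  have hΨ := Set.mem_image_of_mem Ψ hblocks
  rw [Ψ.image_convexHull, hΨx] at hΨ
  refine convexHull_mono ?_ hΨ
  rintro _ ⟨z, hz, rfl⟩
  have hflow : ∀ s, IsUnitFlow G (z s) := fun s => (hz s (Finset.mem_univ s)).1.1
  have hround : ∀ s, IsRounding (x.blocks s).1 (z s).1 ∧
      IsRounding (x.blocks s).2.1 (z s).2.1 ∧ IsRounding (x.blocks s).2.2 (z s).2.2 :=
    fun s => (hz s (Finset.mem_univ s)).1.2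
  refine ⟨⟨?_, ?_, ?_, ?_, ?_, ?_, ?_, ?_⟩, ?_, ?_, ?_, ?_⟩
  · exact fun i s => (hflow s).flow i
  · intro i s p hs hp
    obtain rfl : parent p = s := Subtype.ext
      (hl.children_injOn (parent p).2 s.2 (hcard p) ((hparent p).symm.trans hp))
    rfl
  · intro i p s hs
    exact (congrFun ((hz s (Finset.mem_univ s)).2 (parent p) (Finset.mem_univ _)
      (hparent p ▸ hs)) i).symm
  · exact fun p => (hflow (parent p)).sum_end
  · intro s hs
    exact (hround s).2.1.eq_one (hx.start_root s hs)
  · intro s hs i hi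
    exact (hround s).2.1.eq_zero (hx.start_other s hs i hi)
  · intro k s hs
    exact (hround s).2.2.eq_one (hx.end_sink k s hs)
  · intro k s hs i hi
    exact (hround s).2.2.eq_zero (hx.end_other k s hs i hi)
  · exact fun d s => (hround s).1.eq_zero_or_one (hx1 d s)
  · exact fun i p => (hround (parent p)).2.2.eq_zero_or_one (hx4 i (parent p))
  · exact fun i s => (hround s).2.1.eq_zero_or_one (hx3 i s)
  · exact fun i s => (hround s).2.2.eq_zero_or_one (hx4 i s)

end Gluing

end SteinerLP

theorem theorem1 {V K : Type*} [Fintype V] [DecidableEq V] [Fintype K] [DecidableEq K]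
    (G : SimpleGraph V) [DecidableRel G.Adj] (R : Finset V) (r : V) (hr : r ∈ R)
    (t : K → V) (ht : Set.BijOn t Set.univ ((R : Set V) \ {r}))
    (l : Finset (Finset K)) (hl : SteinerLP.IsLaminarFamily l) :
    convexHull ℝ (SteinerLP.QIP G r t l) = SteinerLP.QLP G r t l :=
  (convexHull_min (SteinerLP.QIP_subset_QLP r t l) (SteinerLP.convex_QLP r t l)).antisymm
    (SteinerLP.QLP_subset_convexHull_QIP hl)
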